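/- Let $\mathcal H_A=\mathcal H_B=(\mathbb C^2)^{\otimes 2}$. Put $P_0=|00\rangle\langle 00|+|11\rangle\langle 11|$ and $P_1=I_4-P_0$. For $\beta\in[0,1]$ let $\mathcal N_\beta$ be the channel given on density operators of $(\mathbb C^2)^{\otimes 2}$ by $$\mathcal N_\beta(\rho)=(1-\beta)\operatorname{Tr}(P_0\rho)\tfrac{P_0}{2}+(1-\beta)\operatorname{Tr}(P_1\rho)\tfrac{P_1}{2}+\beta\tfrac{I_4}{4}$$ and extended linearly, and let $\mathcal E'=\mathcal N_0\otimes\mathcal N_{1/2}$. For $s\in\mathbb R$ let $\mathbb H_s$ be the set of pure states (density operators of rank one) on $\mathcal H_A\otimes\mathcal H_B$ whose entanglement entropy, i.e. the von Neumann entropy $-\operatorname{Tr}(\rho_A\log\rho_A)$ (natural logarithm) of the reduced state $\rho_A=\operatorname{Tr}_B\rho$, is at least $s$. The mechanism $\mathcal E'$ is called $\varepsilon$-private on $\mathbb H_s$ (against local measurement adversaries) if for all finite outcome sets $O_A,O_B$, all POVMs $\{M_a\}_{a\in O_A}$ on $\mathcal H_A$ and $\{M_b\}_{b\in O_B}$ on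 $\mathcal H_B$, all $\rho,\rho'\in\mathbb H_s$ and all $T\subseteq O_A\times O_B$, $$\sum_{(a,b)\in T}\operatorname{Tr}\big((M_a\otimes M_b)\,\mathcal E'(\rho)\big)\le e^{\varepsilon}\sum_{(a,b)\in T}\operatorname{Tr}\big((M_a\otimes M_b)\,\mathcal E'(\rho')\big).$$ The optimal leakage level $\varepsilon^*(s)$ is the infimum of all real $\varepsilon$ for which $\mathcal E'$ is $\varepsilon$-private on $\mathbb H_s$, and $\varepsilon^*(s)=+\infty$ if there is no such $\varepsilon$. **Proposition.** 1. If $s\le\log 2$, then $\varepsilon^*(s)=+\infty$. (For $s=0$ this says that $\mathcal E'$ is not private when no entanglement is required.) 2. If $\log 2<s\le\log 4$ (note that $\log 4$ is the largest possible entanglement entropy), then there is exactly one $\tau=\tau(s)\in[1/2,1]$ with $$s=\log 2-\tau\log\tau-(1-\tau)\log(1-\tau)\qquad(0\log 0:=0),$$ it satisfies $\tau<1$, and $$\varepsilon^*(s)\le\log\frac{3\tau}{1-\tau}<\infty .$$ Moreover $\tau(s)$ is strictly decreasing in $s$ on $(\log 2,\log 4]$. -/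

import Mathlib

noncomputable section

namespace QLDP

open scoped Kronecker ComplexOrder

/-! ### States, reduced states, entropy -/

section States

variable {m n : Type*} [Fintype n]

/-- A density operator: positive semidefinite with unit trace. -/
def IsDensity (ρ : Matrix n n ℂ) : Prop :=
  ρ.PosSemidef ∧ ρ.trace = 1

/-- The partial trace over the second tensor factor. -/
def partialTraceB (ρ : Matrix (m × n) (m × n) ℂ) : Matrix m m ℂ :=
  Matrix.of fun i j => ∑ k, ρ (i, k) (j, k)

theorem partialTraceB_isHermitian {ρ : Matrix (m × n) (m × n) ℂ} (h : ρ.IsHermitian) :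
    (partialTraceB ρ).IsHermitian := by
  ext i j
  simp only [partialTraceB, Matrix.conjTranspose_apply, Matrix.of_apply, star_sum]
  exact Finset.sum_congr rfl fun k _ => h.apply _ _

/-- The von Neumann entropy `- ∑ λⱼ log λⱼ` (natural logarithm, `0 log 0 = 0`) over the
eigenvalues of a Hermitian matrix, counted with multiplicity. -/
def vonNeumannEntropy [DecidableEq n] (ρ : Matrix n n ℂ) (h : ρ.IsHermitian) : ℝ :=
  ∑ j, Real.negMulLog (h.eigenvalues j)

/-- The entanglement entropy of a bipartite state: the entropy of its reduced state on the
first factor. -/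
def entanglementEntropy [Fintype m] [DecidableEq m] (ρ : Matrix (m × n) (m × n) ℂ) (h : ρ.IsHermitian) : ℝ :=
  vonNeumannEntropy (partialTraceB ρ) (partialTraceB_isHermitian h)

/-- The domain `ℍ_s`: bipartite pure states (density operators of rank one) whose entanglement
entropy is at least `s`. -/
def entangledDomain (m n : Type*) [Fintype m] [Fintype n] [DecidableEq m] (s : ℝ) :
    Set (Matrix (m × n) (m × n) ℂ) :=
  {ρ | ∃ h : IsDensity ρ, ρ.rank = 1 ∧ s ≤ entanglementEntropy ρ h.1.isHermitian}

end States

/-! ### Product maps -/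

section Product

variable {m n : Type*} [Fintype m] [Fintype n] [DecidableEq m] [DecidableEq n]

/-- The tensor product `Φ ⊗ Ψ` of two linear maps on matrices, defined on matrix units
by `E_{ij} ⊗ E_{kl} ↦ Φ(E_{ij}) ⊗ Ψ(E_{kl})` and extended linearly. -/
def tensorMap (Φ : Matrix m m ℂ →ₗ[ℂ] Matrix m m ℂ) (Ψ : Matrix n n ℂ →ₗ[ℂ] Matrix n n ℂ) :
    Matrix (m × n) (m × n) ℂ →ₗ[ℂ] Matrix (m × n) (m × n) ℂ where
  toFun ρ := ∑ i, ∑ j, ∑ k, ∑ l,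
    ρ (i, k) (j, l) • (Φ (Matrix.single i j 1) ⊗ₖ Ψ (Matrix.single k l 1))
  map_add' ρ σ := by
    simp only [Matrix.add_apply, add_smul, Finset.sum_add_distrib]
  map_smul' c ρ := by
    simp only [Matrix.smul_apply, smul_eq_mul, mul_smul, Finset.smul_sum, RingHom.id_apply]

/-- The defining property of the tensor product of maps. -/
theorem tensorMap_kronecker (Φ : Matrix m m ℂ →ₗ[ℂ] Matrix m m ℂ)
    (Ψ : Matrix n n ℂ →ₗ[ℂ] Matrix n n ℂ) (X : Matrix m m ℂ) (Y : Matrix n n ℂ) :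
    tensorMap Φ Ψ (X ⊗ₖ Y) = Φ X ⊗ₖ Ψ Y := by
  have hX : Φ X = ∑ i, ∑ j, X i j • Φ (Matrix.single i j 1) := by
    refine (congrArg Φ (Matrix.matrix_eq_sum_single X)).trans ?_
    simp only [map_sum]
    refine Finset.sum_congr rfl fun i _ => Finset.sum_congr rfl fun j _ => ?_
    rw [← map_smul, Matrix.smul_single, smul_eq_mul, mul_one]
  have hY : Ψ Y = ∑ k, ∑ l, Y k l • Ψ (Matrix.single k l 1) := by
    refine (congrArg Ψ (Matrix.matrix_eq_sum_single Y)).trans ?_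
    simp only [map_sum]
    refine Finset.sum_congr rfl fun i _ => Finset.sum_congr rfl fun j _ => ?_
    rw [← map_smul, Matrix.smul_single, smul_eq_mul, mul_one]
  rw [hX, hY]
  ext ⟨a, b⟩ ⟨c, d⟩
  simp only [tensorMap, LinearMap.coe_mk, AddHom.coe_mk, Matrix.sum_apply, Matrix.smul_apply,
    Matrix.kroneckerMap_apply, smul_eq_mul, Finset.sum_mul]
  refine Finset.sum_congr rfl fun i _ => Finset.sum_congr rfl fun j _ => ?_
  simp only [Finset.mul_sum]
  refine Finset.sum_congr rfl fun k _ => Finset.sum_congr rfl fun l _ => ?_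
  ring

end Product

/-! ### Local measurements and privacy -/

/-- A positive operator-valued measurement with outcomes in `O`. -/
structure POVM (O n : Type*) [Fintype O] [Fintype n] [DecidableEq n] where
  /-- The element of the measurement belonging to an outcome. -/
  elem : O → Matrix n n ℂ
  posSemidef : ∀ o, (elem o).PosSemidef
  sum_eq_one : ∑ o, elem o = 1

section Privacy

variable {m n : Type*} [Fintype m] [Fintype n] [DecidableEq m] [DecidableEq n]

/-- The probability that the product measurement `{M_a ⊗ M_b}` on the state `σ` has its
outcome in `T`. -/
def localProb {OA OB : Type*} [Fintype OA] [Fintype OB] (MA : POVM OA m) (MB : POVM OB n)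
    (σ : Matrix (m × n) (m × n) ℂ) (T : Finset (OA × OB)) : ℝ :=
  ∑ o ∈ T, (((MA.elem o.1 ⊗ₖ MB.elem o.2) * σ).trace).re

/-- `ε`-quantum local differential privacy against local measurement adversaries on the
entanglement-constrained domain `ℍ_s`. -/
def IsECLMPrivate (E : Matrix (m × n) (m × n) ℂ →ₗ[ℂ] Matrix (m × n) (m × n) ℂ)
    (s ε : ℝ) : Prop :=
  ∀ (OA OB : Type) [Fintype OA] [Fintype OB] (MA : POVM OA m) (MB : POVM OB n),
    ∀ ρ ∈ entangledDomain m n s, ∀ ρ' ∈ entangledDomain m n s, ∀ T : Finset (OA × OB),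
      localProb MA MB (E ρ) T ≤ Real.exp ε * localProb MA MB (E ρ') T

/-- The optimal leakage level `ε*(s)`: the infimum, in the extended reals, of all `ε` for which
the mechanism is `ε`-private on `ℍ_s`. It is `⊤` when there is no such `ε`. -/
def optimalLeakage (E : Matrix (m × n) (m × n) ℂ →ₗ[ℂ] Matrix (m × n) (m × n) ℂ)
    (s : ℝ) : EReal :=
  sInf ((fun ε : ℝ => (ε : EReal)) '' {ε : ℝ | IsECLMPrivate E s ε})

end Privacy

/-! ### The block-depolarizing mechanism on two qubits -/

/-- Index set of the computational basis of two qubits. -/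
abbrev TwoQubit : Type := Fin 2 × Fin 2

/-- The projector `|00⟩⟨00| + |11⟩⟨11|` onto the even subspace. -/
def P0 : Matrix TwoQubit TwoQubit ℂ :=
  Matrix.single (0, 0) (0, 0) 1 + Matrix.single (1, 1) (1, 1) 1

/-- The projector onto the odd subspace. -/
def P1 : Matrix TwoQubit TwoQubit ℂ := 1 - P0

/-- The block-depolarizing map
`ρ ↦ (1-β) Tr(P₀ρ) P₀/2 + (1-β) Tr(P₁ρ) P₁/2 + β Tr(ρ) I/4`, as a linear map on all matrices;
`Tr(ρ) = 1` on density operators. -/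
def blockDepolarizing (β : ℝ) :
    Matrix TwoQubit TwoQubit ℂ →ₗ[ℂ] Matrix TwoQubit TwoQubit ℂ where
  toFun ρ := ((1 - (β : ℂ)) * (P0 * ρ).trace / 2) • P0
    + ((1 - (β : ℂ)) * (P1 * ρ).trace / 2) • P1 + ((β : ℂ) * ρ.trace / 4) • 1
  map_add' ρ σ := by
    simp only [Matrix.mul_add, Matrix.trace_add]
    module
  map_smul' c ρ := by
    simp only [Matrix.mul_smul, Matrix.trace_smul, smul_eq_mul, RingHom.id_apply]
    module

/-- The asymmetric product mechanism `𝒩_0 ⊗ 𝒩_{1/2}`. -/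
def asymmetricMechanism :
    Matrix (TwoQubit × TwoQubit) (TwoQubit × TwoQubit) ℂ →ₗ[ℂ]
      Matrix (TwoQubit × TwoQubit) (TwoQubit × TwoQubit) ℂ :=
  tensorMap (blockDepolarizing 0) (blockDepolarizing (1 / 2))

end QLDP

end

namespace QLDP

open scoped Kronecker ComplexOrder
open Matrix Real

/-! ### Entropy of a matrix and of its diagonal -/

/-! Both factors of the mechanism kill off-diagonal matrix units, so outcome probabilities depend
only on the diagonal of `ρ` (`outcomeProb_eq`). On the first party, `𝒩_0` retains only the parity of
the basis state; on the second, the noise of `𝒩_{1/2}` confines the weights to a ratio of at most 3.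
Up to this factor 3, a probability is governed by the even and odd weights of `ρ_A`
(`outcomeProb_bounds`).

Entropy controls these weights: dephasing and then grouping by parity gives `S(ρ_A) ≤ log 2 + h(e)`,
with `e` the even weight and `h` the binary entropy. Entropy at least `log 2 + h(t)` with `t ≥ 1/2`
thus puts both weights in `[1 - t, t]` (`weights_bounds`), and the likelihood ratio is at most `3t /
(1 - t)`.

At `log 2` this control is lost: each parity block supports a state of entropy `log 2`, and a parity
measurement separates the two blocks perfectly. -/

theorem vonNeumannEntropy_diagonal {n : Type*} [Fintype n] [DecidableEq n] {A : Matrix n n ℂ}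
    (h : A.IsHermitian) (d : n → ℝ) (hd : A = diagonal fun i => (d i : ℂ)) :
    vonNeumannEntropy A h = ∑ i, negMulLog (d i) := by
  -- Eigenvalues are indexed by size, so they match `d` only as a multiset, namely the roots of the
  -- characteristic polynomial.
  have h1 := h.roots_charpoly_eq_eigenvalues
  have h2 : A.charpoly.roots = Multiset.map (fun i => (d i : ℂ)) Finset.univ.val := by
    rw [hd, charpoly_diagonal]
    have := Polynomial.roots_multiset_prod_X_sub_C (Finset.univ.val.map fun i => (d i : ℂ))
    rwa [Multiset.map_map] at this
  have h3 := congrArg (fun s => (s.map fun z : ℂ => negMulLog z.re).sum) (h1.symm.trans h2)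
  rwa [Multiset.map_map, Multiset.map_map] at h3

/-- The weights `‖U i j‖ ^ 2` form a doubly stochastic matrix; row sums serve Jensen's inequality,
column sums restore the entropy afterwards. -/
theorem diag_re_eq_sum_eigenvalues {n : Type*} [Fintype n] [DecidableEq n] {A : Matrix n n ℂ}
    (h : A.IsHermitian) (i : n) :
    (A i i).re = ∑ j, ‖(h.eigenvectorUnitary : Matrix n n ℂ) i j‖ ^ 2 * h.eigenvalues j := by
  have hs := h.spectral_theorem
  have : A i i = ((∑ j, ‖(h.eigenvectorUnitary : Matrix n n ℂ) i j‖ ^ 2 * h.eigenvalues j : ℝ) : ℂ) := by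
    conv_lhs => rw [hs]
    rw [Unitary.conjStarAlgAut_apply, mul_apply]
    push_cast
    refine Finset.sum_congr rfl fun j _ => ?_
    rw [mul_diagonal, star_apply, ← Complex.mul_conj']
    simp only [Function.comp_apply, Complex.coe_algebraMap, RCLike.star_def]
    ring
  rw [this, Complex.ofReal_re]

theorem unitary_row_sum {n : Type*} [Fintype n] [DecidableEq n] (U : unitaryGroup n ℂ) (i : n) :
    ∑ j, ‖(U : Matrix n n ℂ) i j‖ ^ 2 = 1 := by
  have h := congrFun (congrFun (Unitary.coe_mul_star_self U) i) i
  rw [mul_apply, one_apply_eq] at h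
  have h2 : ((∑ j, ‖(U : Matrix n n ℂ) i j‖ ^ 2 : ℝ) : ℂ) = 1 := by
    rw [← h]
    push_cast
    exact Finset.sum_congr rfl fun j _ => by rw [star_apply, ← Complex.mul_conj']; rfl
  exact_mod_cast h2

theorem unitary_col_sum {n : Type*} [Fintype n] [DecidableEq n] (U : unitaryGroup n ℂ) (j : n) :
    ∑ i, ‖(U : Matrix n n ℂ) i j‖ ^ 2 = 1 := by
  have h := congrFun (congrFun (Unitary.coe_star_mul_self U) j) j
  rw [mul_apply, one_apply_eq] at h
  have h2 : ((∑ i, ‖(U : Matrix n n ℂ) i j‖ ^ 2 : ℝ) : ℂ) = 1 := by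
    rw [← h]
    push_cast
    exact Finset.sum_congr rfl fun i _ => by rw [star_apply, ← Complex.conj_mul']; rfl
  exact_mod_cast h2

/-- Dephasing in a fixed basis does not decrease the entropy. -/
theorem vonNeumannEntropy_le_diag {n : Type*} [Fintype n] [DecidableEq n] {A : Matrix n n ℂ}
    (h : A.PosSemidef) :
    vonNeumannEntropy A h.isHermitian ≤ ∑ i, negMulLog (A i i).re := by
  set U := h.isHermitian.eigenvectorUnitary
  have jensen (i : n) : ∑ j, ‖(U : Matrix n n ℂ) i j‖ ^ 2 * negMulLog (h.isHermitian.eigenvalues j)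
      ≤ negMulLog (A i i).re := by
    rw [diag_re_eq_sum_eigenvalues h.isHermitian]
    exact concaveOn_negMulLog.le_map_sum (fun j _ => by positivity) (unitary_row_sum U i)
      (fun j _ => h.eigenvalues_nonneg j)
  refine le_trans (le_of_eq ?_) (Finset.sum_le_sum fun i _ => jensen i)
  rw [Finset.sum_comm]
  simp only [← Finset.sum_mul, unitary_col_sum, one_mul]
  rfl

/-- Midpoint concavity: splitting a mass in two adds at most one bit of entropy per unit mass. -/
theorem negMulLog_add_negMulLog_le {x y : ℝ} (hx : 0 ≤ x) (hy : 0 ≤ y) :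
    negMulLog x + negMulLog y ≤ negMulLog (x + y) + (x + y) * log 2 := by
  have h := concaveOn_negMulLog.2 hx hy (by norm_num : (0 : ℝ) ≤ 1 / 2)
    (by norm_num : (0 : ℝ) ≤ 1 / 2) (by norm_num)
  simp only [smul_eq_mul] at h
  have h2 := negMulLog_mul (x + y) (1 / 2)
  have h3 : negMulLog (1 / 2) = 1 / 2 * log 2 := by
    rw [negMulLog, one_div, log_inv]; ring
  rw [h3] at h2
  rw [← mul_add, ← mul_add (1 / 2) x y, mul_comm (1 / 2) (x + y), h2] at h
  linarith

/-! ### Partial trace -/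

theorem partialTraceB_posSemidef {m n : Type*} [Finite m] [Fintype n]
    {ρ : Matrix (m × n) (m × n) ℂ} (h : ρ.PosSemidef) : (partialTraceB ρ).PosSemidef := by
  have : partialTraceB ρ = ∑ k, ρ.submatrix (fun i => (i, k)) (fun i => (i, k)) := by
    ext i j
    simp [partialTraceB, Matrix.sum_apply]
  rw [this]
  exact posSemidef_sum _ fun k _ => h.submatrix _

theorem trace_partialTraceB {m n : Type*} [Fintype m] [Fintype n]
    (ρ : Matrix (m × n) (m × n) ℂ) : (partialTraceB ρ).trace = ρ.trace := by
  simp [partialTraceB, trace, Fintype.sum_prod_type]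

/-! ### The mechanism -/

theorem P0_eq_diagonal : P0 = diagonal fun x => if x.1 = x.2 then 1 else 0 := by
  ext ⟨a, b⟩ ⟨c, d⟩
  fin_cases a <;> fin_cases b <;> fin_cases c <;> fin_cases d <;> simp [P0, single, diagonal]

theorem P1_eq_diagonal : P1 = diagonal fun x => if x.1 = x.2 then 0 else 1 := by
  rw [P1, P0_eq_diagonal, ← diagonal_one, diagonal_sub]
  congr 1
  ext x
  split_ifs <;> simp

/-- The diagonal of the image of the basis state `i` under the block-depolarizing map. -/
noncomputable def blockWeight (β : ℝ) (i l : TwoQubit) : ℝ :=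
  (if (i.1 = i.2 ↔ l.1 = l.2) then (1 - β) / 2 else 0) + β / 4

theorem blockDepolarizing_apply (β : ℝ) (X : Matrix TwoQubit TwoQubit ℂ) :
    blockDepolarizing β X = ((1 - (β : ℂ)) * (P0 * X).trace / 2) • P0
      + ((1 - (β : ℂ)) * (P1 * X).trace / 2) • P1 + ((β : ℂ) * X.trace / 4) • 1 :=
  rfl

theorem trace_diagonal_mul_single {n : Type*} [Fintype n] [DecidableEq n] (d : n → ℂ) (i j : n) :
    (diagonal d * single i j 1).trace = if i = j then d i else 0 := by
  rw [trace_mul_single, diagonal_apply]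
  simp [eq_comm]
  grind

theorem blockDepolarizing_single (β : ℝ) (i j : TwoQubit) :
    blockDepolarizing β (single i j 1) =
      if i = j then diagonal fun l => (blockWeight β i l : ℂ) else 0 := by
  rw [blockDepolarizing_apply, P0_eq_diagonal, P1_eq_diagonal]
  split_ifs with h
  · subst h
    rw [← diagonal_one, trace_diagonal_mul_single, trace_diagonal_mul_single]
    simp only [trace_single_eq_same, if_true, ← diagonal_smul, diagonal_add]
    congr 1
    ext l
    by_cases h1 : i.1 = i.2 <;> by_cases h2 : l.1 = l.2 <;> simp [blockWeight, h1, h2]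
  · simp [trace_diagonal_mul_single, h, trace_single_eq_of_ne _ _ _ h]

theorem tensorMap_of_single {m n : Type*} [Fintype m] [Fintype n] [DecidableEq m] [DecidableEq n]
    {Φ : Matrix m m ℂ →ₗ[ℂ] Matrix m m ℂ} {Ψ : Matrix n n ℂ →ₗ[ℂ] Matrix n n ℂ}
    {f : m → Matrix m m ℂ} {g : n → Matrix n n ℂ}
    (hΦ : ∀ i j, Φ (single i j 1) = if i = j then f i else 0)
    (hΨ : ∀ i j, Ψ (single i j 1) = if i = j then g i else 0)
    (ρ : Matrix (m × n) (m × n) ℂ) :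
    tensorMap Φ Ψ ρ = ∑ i, ∑ k, ρ (i, k) (i, k) • (f i ⊗ₖ g k) := by
  have h : tensorMap Φ Ψ ρ = ∑ i, ∑ j, ∑ k, ∑ l,
    ρ (i, k) (j, l) • (Φ (single i j 1) ⊗ₖ Ψ (single k l 1)) := rfl
  rw [h]
  refine Finset.sum_congr rfl fun i _ => ?_
  rw [Finset.sum_eq_single i]
  · refine Finset.sum_congr rfl fun k _ => ?_
    rw [Finset.sum_eq_single k]
    · simp [hΦ, hΨ]
    · intro l _ hl
      simp [hΨ, hl.symm]
    · simp
  · intro j _ hj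
    simp [hΦ, hj.symm]
  · simp

theorem ofReal_re_diag {n : Type*} {A : Matrix n n ℂ} (h : A.PosSemidef) (i : n) :
    ((A i i).re : ℂ) = A i i :=
  Complex.ext rfl (Complex.le_def.1 h.diag_nonneg).2

theorem diag_re_nonneg {n : Type*} {A : Matrix n n ℂ} (h : A.PosSemidef) (i : n) :
    0 ≤ (A i i).re :=
  (Complex.le_def.1 h.diag_nonneg).1

theorem trace_mul_diagonal_ofReal {n : Type*} [Fintype n] [DecidableEq n] {A : Matrix n n ℂ}
    (h : A.PosSemidef) (w : n → ℝ) :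
    (A * diagonal fun l => (w l : ℂ)).trace = ((∑ l, (A l l).re * w l : ℝ) : ℂ) := by
  push_cast
  simp only [ofReal_re_diag h, trace, diag_apply, mul_diagonal]

/-- The experiment is classical: the diagonal of `ρ` is a distribution on pairs `(i, k)`, sent
through two independent noise kernels and then measured. -/
theorem outcomeProb_eq {A B : Matrix TwoQubit TwoQubit ℂ} (hA : A.PosSemidef) (hB : B.PosSemidef)
    {ρ : Matrix (TwoQubit × TwoQubit) (TwoQubit × TwoQubit) ℂ} (hρ : ρ.PosSemidef) :
    (((A ⊗ₖ B) * asymmetricMechanism ρ).trace).re =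
      ∑ i, ∑ k, (ρ (i, k) (i, k)).re * ((∑ l, (A l l).re * blockWeight 0 i l) *
        ∑ l, (B l l).re * blockWeight (1 / 2) k l) := by
  rw [asymmetricMechanism, tensorMap_of_single (blockDepolarizing_single 0)
    (blockDepolarizing_single (1 / 2))]
  simp only [Finset.mul_sum, Matrix.mul_smul, ← mul_kronecker_mul, trace_sum, trace_smul,
    trace_kronecker, trace_mul_diagonal_ofReal hA, trace_mul_diagonal_ofReal hB]
  rw [← Complex.ofReal_re (∑ i, ∑ k, _)]
  congr 1
  push_cast
  simp only [ofReal_re_diag hρ, smul_eq_mul, Finset.mul_sum]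

/-- With `β = 1/2` the uniform noise gives `β / 4 = 1/8` and the matching block adds `(1 - β) / 2 =
1/4`. The ratio of these bounds is the 3 in the leakage. -/
theorem blockWeight_half_bounds (k l : TwoQubit) :
    1 / 8 ≤ blockWeight (1 / 2) k l ∧ blockWeight (1 / 2) k l ≤ 3 / 8 := by
  unfold blockWeight
  split_ifs <;> norm_num

/-- The probability of the even block in a reduced state. -/
noncomputable def evenWeight (A : Matrix TwoQubit TwoQubit ℂ) : ℝ :=
  (A (0, 0) (0, 0)).re + (A (1, 1) (1, 1)).re

/-- The probability of the odd block in a reduced state. -/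
noncomputable def oddWeight (A : Matrix TwoQubit TwoQubit ℂ) : ℝ :=
  (A (0, 1) (0, 1)).re + (A (1, 0) (1, 0)).re

theorem evenWeight_add_oddWeight {A : Matrix TwoQubit TwoQubit ℂ} (h : A.trace = 1) :
    evenWeight A + oddWeight A = 1 := by
  have := congrArg Complex.re h
  simp [trace, Fintype.sum_prod_type, Fin.sum_univ_two] at this
  simp only [evenWeight, oddWeight]
  linarith

theorem sum_diag_mul_blockWeight_zero (A : Matrix TwoQubit TwoQubit ℂ) (i : TwoQubit) :
    ∑ l, (A l l).re * blockWeight 0 i l =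
      (if i.1 = i.2 then evenWeight A else oddWeight A) / 2 := by
  by_cases h : i.1 = i.2 <;>
    simp [blockWeight, h, Fintype.sum_prod_type, Fin.sum_univ_two, evenWeight, oddWeight] <;> ring

/-- Once the second party's factor is a constant `c`, the sum over `k` is a partial trace. -/
theorem sum_partialTraceB_diag (ρ : Matrix (TwoQubit × TwoQubit) (TwoQubit × TwoQubit) ℂ)
    (A : Matrix TwoQubit TwoQubit ℂ) (c : ℝ) :
    ∑ i, ∑ k, (ρ (i, k) (i, k)).re * ((∑ l, (A l l).re * blockWeight 0 i l) * c) =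
      (evenWeight (partialTraceB ρ) * evenWeight A + oddWeight (partialTraceB ρ) * oddWeight A)
        * c / 2 := by
  simp only [sum_diag_mul_blockWeight_zero, ← Finset.sum_mul, ← Complex.re_sum]
  simp only [Fintype.sum_prod_type (f := fun i : TwoQubit => _ * _), Fin.sum_univ_two]
  simp [evenWeight, oddWeight, partialTraceB]
  ring

theorem outcomeProb_bounds {A B : Matrix TwoQubit TwoQubit ℂ} (hA : A.PosSemidef)
    (hB : B.PosSemidef) {ρ : Matrix (TwoQubit × TwoQubit) (TwoQubit × TwoQubit) ℂ}
    (hρ : ρ.PosSemidef) :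
    (evenWeight (partialTraceB ρ) * evenWeight A + oddWeight (partialTraceB ρ) * oddWeight A)
        * ((∑ l, (B l l).re) / 8) / 2 ≤ (((A ⊗ₖ B) * asymmetricMechanism ρ).trace).re ∧
    (((A ⊗ₖ B) * asymmetricMechanism ρ).trace).re ≤
      (evenWeight (partialTraceB ρ) * evenWeight A + oddWeight (partialTraceB ρ) * oddWeight A)
        * (3 * (∑ l, (B l l).re) / 8) / 2 := by
  have hw (i : TwoQubit) : 0 ≤ ∑ l, (A l l).re * blockWeight 0 i l := by
    refine Finset.sum_nonneg fun l _ => mul_nonneg (diag_re_nonneg hA l) ?_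
    unfold blockWeight
    split_ifs <;> norm_num
  rw [outcomeProb_eq hA hB hρ, ← sum_partialTraceB_diag, ← sum_partialTraceB_diag]
  constructor
  · refine Finset.sum_le_sum fun i _ => Finset.sum_le_sum fun k _ =>
      mul_le_mul_of_nonneg_left (mul_le_mul_of_nonneg_left ?_ (hw i)) (diag_re_nonneg hρ _)
    rw [Finset.sum_div]
    refine Finset.sum_le_sum fun l _ => ?_
    nlinarith [diag_re_nonneg hB l, (blockWeight_half_bounds k l).1]
  · refine Finset.sum_le_sum fun i _ => Finset.sum_le_sum fun k _ =>
      mul_le_mul_of_nonneg_left (mul_le_mul_of_nonneg_left ?_ (hw i)) (diag_re_nonneg hρ _)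
    rw [Finset.mul_sum, Finset.sum_div]
    refine Finset.sum_le_sum fun l _ => ?_
    nlinarith [diag_re_nonneg hB l, (blockWeight_half_bounds k l).2]

/-! ### Privacy above `log 2` -/

/-- Chain rule for the dephased state: the parity has entropy `binEntropy (evenWeight A)`, and the
position inside a two-element block adds at most `log 2`. -/
theorem vonNeumannEntropy_le_binEntropy_evenWeight {A : Matrix TwoQubit TwoQubit ℂ}
    (h : A.PosSemidef) (htr : A.trace = 1) :
    vonNeumannEntropy A h.isHermitian ≤ log 2 + binEntropy (evenWeight A) := by
  refine (vonNeumannEntropy_le_diag h).trans ?_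
  have h1 := negMulLog_add_negMulLog_le (diag_re_nonneg h (0, 0)) (diag_re_nonneg h (1, 1))
  have h2 := negMulLog_add_negMulLog_le (diag_re_nonneg h (0, 1)) (diag_re_nonneg h (1, 0))
  have h3 := evenWeight_add_oddWeight htr
  rw [binEntropy_eq_negMulLog_add_negMulLog_one_sub, ← h3, add_sub_cancel_left]
  change _ ≤ negMulLog (evenWeight A) + evenWeight A * log 2 at h1
  change _ ≤ negMulLog (oddWeight A) + oddWeight A * log 2 at h2
  have h4 : evenWeight A * log 2 + oddWeight A * log 2 = log 2 := by rw [← add_mul, h3, one_mul]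
  simp only [Fintype.sum_prod_type, Fin.sum_univ_two]
  linarith

theorem le_of_binEntropy_le {t a : ℝ} (ht : t ∈ Set.Icc (2⁻¹ : ℝ) 1) (ha : a ≤ 1)
    (h : binEntropy t ≤ binEntropy a) : a ≤ t := by
  by_contra! hlt
  exact absurd h (not_le.2 (binEntropy_strictAntiOn ht ⟨ht.1.trans hlt.le, ha⟩ hlt))

theorem weights_bounds {A : Matrix TwoQubit TwoQubit ℂ} (h : A.PosSemidef) (htr : A.trace = 1)
    {t : ℝ} (ht : t ∈ Set.Icc (2⁻¹ : ℝ) 1)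
    (hs : log 2 + binEntropy t ≤ vonNeumannEntropy A h.isHermitian) :
    evenWeight A ∈ Set.Icc (1 - t) t ∧ oddWeight A ∈ Set.Icc (1 - t) t := by
  have h1 := vonNeumannEntropy_le_binEntropy_evenWeight h htr
  have h2 := evenWeight_add_oddWeight htr
  have he : 0 ≤ evenWeight A := add_nonneg (diag_re_nonneg h _) (diag_re_nonneg h _)
  have ho : 0 ≤ oddWeight A := add_nonneg (diag_re_nonneg h _) (diag_re_nonneg h _)
  have h3 := le_of_binEntropy_le ht (a := evenWeight A) (by linarith) (by linarith)
  -- The symmetry of `binEntropy` turns the upper bound into the lower one.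
  have h4 := le_of_binEntropy_le ht (a := 1 - evenWeight A) (by linarith)
    (by rw [binEntropy_one_sub]; linarith)
  refine ⟨⟨?_, ?_⟩, ?_, ?_⟩ <;> linarith

theorem isECLMPrivate_asymmetricMechanism {t : ℝ} (ht : t ∈ Set.Ico (2⁻¹ : ℝ) 1) :
    IsECLMPrivate asymmetricMechanism (log 2 + binEntropy t) (log (3 * t / (1 - t))) := by
  intro OA OB _ _ MA MB ρ hρ ρ' hρ' T
  obtain ⟨hd, -, hs⟩ := hρ
  obtain ⟨hd', -, hs'⟩ := hρ'
  have ht' : t ∈ Set.Icc (2⁻¹ : ℝ) 1 := ⟨ht.1, ht.2.le⟩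
  have h2 := ht.1
  have hlt : 0 < 1 - t := sub_pos.2 ht.2
  have ht0 : 0 < t := lt_of_lt_of_le (by norm_num) ht.1
  obtain ⟨⟨-, he⟩, -, ho⟩ := weights_bounds (partialTraceB_posSemidef hd.1)
    ((trace_partialTraceB ρ).trans hd.2) ht' hs
  obtain ⟨⟨he', -⟩, ho', -⟩ := weights_bounds (partialTraceB_posSemidef hd'.1)
    ((trace_partialTraceB ρ').trans hd'.2) ht' hs'
  rw [exp_log (by positivity)]
  unfold localProb
  rw [Finset.mul_sum]
  -- It suffices to compare single outcomes, since both sides are sums over `T`.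
  refine Finset.sum_le_sum fun o _ => ?_
  have hA := MA.posSemidef o.1
  have hB := MB.posSemidef o.2
  have hx : 0 ≤ evenWeight (MA.elem o.1) := add_nonneg (diag_re_nonneg hA _) (diag_re_nonneg hA _)
  have hy : 0 ≤ oddWeight (MA.elem o.1) := add_nonneg (diag_re_nonneg hA _) (diag_re_nonneg hA _)
  have hu : 0 ≤ ∑ l, (MB.elem o.2 l l).re := Finset.sum_nonneg fun l _ => diag_re_nonneg hB l
  refine (outcomeProb_bounds hA hB hd.1).2.trans ?_
  refine le_trans ?_ (mul_le_mul_of_nonneg_left (outcomeProb_bounds hA hB hd'.1).1 (by positivity))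
  set x := evenWeight (MA.elem o.1)
  set y := oddWeight (MA.elem o.1)
  set u := ∑ l, (MB.elem o.2 l l).re
  -- The parity weights of `ρ` are at most `t` and those of `ρ'` at least `1 - t`.
  calc _ ≤ (t * x + t * y) * (3 * u / 8) / 2 := by gcongr
    _ = 3 * t / (1 - t) * (((1 - t) * x + (1 - t) * y) * (u / 8) / 2) := by
      field_simp
    _ ≤ _ := by gcongr

/-! ### No privacy up to `log 2` -/

/-- Amplitudes of `(|0c⟩|00⟩ + |1(1+c)⟩|11⟩) / √2`. -/
noncomputable def blockBellVec (c : Fin 2) (p : TwoQubit × TwoQubit) : ℂ :=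
  if p.1 = (p.2.1, p.2.1 + c) ∧ p.2.1 = p.2.2 then ((√2)⁻¹ : ℝ) else 0

/-- A maximally entangled state between one parity block of the first party and a two-dimensional
space of the second. -/
noncomputable def blockBell (c : Fin 2) : Matrix (TwoQubit × TwoQubit) (TwoQubit × TwoQubit) ℂ :=
  vecMulVec (blockBellVec c) (star (blockBellVec c))

theorem blockBell_apply (c : Fin 2) (p q : TwoQubit × TwoQubit) :
    blockBell c p q = if (p.1 = (p.2.1, p.2.1 + c) ∧ p.2.1 = p.2.2) ∧
      (q.1 = (q.2.1, q.2.1 + c) ∧ q.2.1 = q.2.2) then 1 / 2 else 0 := by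
  have h : (((√2)⁻¹ : ℝ) : ℂ) * (((√2)⁻¹ : ℝ) : ℂ) = 1 / 2 := by
    rw [← Complex.ofReal_mul, ← mul_inv, mul_self_sqrt (by norm_num)]
    norm_num
  unfold blockBell blockBellVec
  rw [vecMulVec_apply, Pi.star_apply]
  split_ifs <;> simp_all [-Complex.ofReal_inv]

theorem partialTraceB_blockBell (c : Fin 2) :
    partialTraceB (blockBell c) =
      diagonal fun x => (((if x.2 = x.1 + c then 1 / 2 else 0 : ℝ)) : ℂ) := by
  ext ⟨a, b⟩ ⟨a', b'⟩
  simp only [partialTraceB, of_apply, blockBell_apply]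
  fin_cases c <;> fin_cases a <;> fin_cases b <;> fin_cases a' <;> fin_cases b' <;>
    simp [Fintype.sum_prod_type, Fin.sum_univ_two, diagonal]

theorem blockBell_isDensity (c : Fin 2) : IsDensity (blockBell c) := by
  refine ⟨posSemidef_vecMulVec_self_star _, ?_⟩
  rw [← trace_partialTraceB, partialTraceB_blockBell]
  fin_cases c <;> simp [trace, Fintype.sum_prod_type, Fin.sum_univ_two] <;> norm_num

theorem blockBell_rank (c : Fin 2) : (blockBell c).rank = 1 := by
  -- An outer product has rank at most one; rank zero would contradict trace one.
  refine le_antisymm (rank_vecMulVec_le _ _) (Nat.one_le_iff_ne_zero.2 fun h => ?_)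
  have h0 := (blockBell_isDensity c).2
  rw [rank, Submodule.finrank_eq_zero, LinearMap.range_eq_bot] at h
  rw [← toLin'_apply', LinearEquiv.map_eq_zero_iff] at h
  rw [h, trace_zero] at h0
  exact zero_ne_one h0

theorem blockBell_mem_entangledDomain (c : Fin 2) {s : ℝ} (hs : s ≤ log 2) :
    blockBell c ∈ entangledDomain TwoQubit TwoQubit s := by
  refine ⟨blockBell_isDensity c, blockBell_rank c, hs.trans (le_of_eq ?_)⟩
  rw [entanglementEntropy, vonNeumannEntropy_diagonal _ _ (partialTraceB_blockBell c)]
  fin_cases c <;> simp [Fintype.sum_prod_type, negMulLog]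

theorem P0_posSemidef : P0.PosSemidef := by
  rw [P0_eq_diagonal, posSemidef_diagonal_iff]
  intro x
  split_ifs <;> simp

theorem P1_posSemidef : P1.PosSemidef := by
  rw [P1_eq_diagonal, posSemidef_diagonal_iff]
  intro x
  split_ifs <;> simp

/-- The measurement of the parity block. -/
noncomputable def parityPOVM : POVM (Fin 2) TwoQubit where
  elem := ![P0, P1]
  posSemidef o := by
    fin_cases o
    · exact P0_posSemidef
    · exact P1_posSemidef
  sum_eq_one := by simp [Fin.sum_univ_two, P1]

/-- The trivial measurement. -/
noncomputable def trivialPOVM : POVM Unit TwoQubit where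
  elem _ := 1
  posSemidef _ := PosSemidef.one
  sum_eq_one := by simp

/-- The two states occupy opposite parity blocks of the first party, and `𝒩_0` preserves block
weights. -/
theorem localProb_parity_blockBell (c : Fin 2) :
    localProb parityPOVM trivialPOVM (asymmetricMechanism (blockBell c)) {(1, ())} =
      if c = 0 then 0 else 1 := by
  have hone (k : TwoQubit) :
      ∑ l, ((1 : Matrix TwoQubit TwoQubit ℂ) l l).re * blockWeight (1 / 2) k l = 1 := by
    by_cases h : k.1 = k.2 <;>
      simp [blockWeight, h, Fintype.sum_prod_type, Fin.sum_univ_two] <;> norm_num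
  rw [localProb, Finset.sum_singleton]
  change (((P1 ⊗ₖ (1 : Matrix TwoQubit TwoQubit ℂ)) * _).trace).re = _
  rw [outcomeProb_eq P1_posSemidef PosSemidef.one (blockBell_isDensity c).1]
  simp only [hone, sum_partialTraceB_diag, partialTraceB_blockBell, P1_eq_diagonal]
  fin_cases c
  · simp [evenWeight, oddWeight]
  · simp [evenWeight, oddWeight]
    norm_num

theorem not_isECLMPrivate_of_le_log_two {s : ℝ} (hs : s ≤ log 2) (ε : ℝ) :
    ¬ IsECLMPrivate asymmetricMechanism s ε := fun h => by
  have := h (Fin 2) Unit parityPOVM trivialPOVM _ (blockBell_mem_entangledDomain 1 hs) _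
    (blockBell_mem_entangledDomain 0 hs) {(1, ())}
  rw [localProb_parity_blockBell, localProb_parity_blockBell] at this
  -- The inequality reads `1 ≤ exp ε * 0`.
  norm_num at this

/-! ### The inverse of the binary entropy -/

theorem exists_binEntropy_eq {y : ℝ} (hy : y ∈ Set.Ioc 0 (log 2)) :
    ∃ t ∈ Set.Ico (2⁻¹ : ℝ) 1, binEntropy t = y := by
  obtain ⟨t, ht, h⟩ := intermediate_value_Icc' (by norm_num : (2⁻¹ : ℝ) ≤ 1)
    binEntropy_continuous.continuousOn (by simpa using ⟨hy.1.le, hy.2⟩ : y ∈ Set.Icc _ _)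
  refine ⟨t, ⟨ht.1, lt_of_le_of_ne ht.2 ?_⟩, h⟩
  -- The endpoint `t = 1` is excluded because its binary entropy is `0 < y`.
  rintro rfl
  exact hy.1.ne (by simpa using h)

theorem log_two_add_binEntropy (t : ℝ) :
    log 2 + binEntropy t = log 2 - t * log t - (1 - t) * log (1 - t) := by
  rw [binEntropy_eq_negMulLog_add_negMulLog_one_sub, negMulLog, negMulLog]
  ring

end QLDP

theorem mainTheorem7 :
    (∀ s : ℝ, s ≤ Real.log 2 →
      QLDP.optimalLeakage QLDP.asymmetricMechanism s = ⊤) ∧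
    ∃ τ : ℝ → ℝ,
      StrictAntiOn τ (Set.Ioc (Real.log 2) (Real.log 4)) ∧
      ∀ s ∈ Set.Ioc (Real.log 2) (Real.log 4),
        (∀ t ∈ Set.Icc (1 / 2 : ℝ) 1,
          s = Real.log 2 - t * Real.log t - (1 - t) * Real.log (1 - t) ↔ t = τ s) ∧
        1 / 2 ≤ τ s ∧ τ s < 1 ∧
        QLDP.optimalLeakage QLDP.asymmetricMechanism s ≤
          ((Real.log (3 * τ s / (1 - τ s)) : ℝ) : EReal) := by
  have hlog : Real.log 4 = Real.log 2 + Real.log 2 := by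
    rw [← Real.log_mul (by norm_num) (by norm_num)]
    norm_num
  have hex (s : ℝ) : ∃ t : ℝ, s ∈ Set.Ioc (Real.log 2) (Real.log 4) →
      t ∈ Set.Ico (2⁻¹ : ℝ) 1 ∧ Real.log 2 + Real.binEntropy t = s := by
    by_cases hs : s ∈ Set.Ioc (Real.log 2) (Real.log 4)
    · obtain ⟨t, ht, h⟩ := QLDP.exists_binEntropy_eq (y := s - Real.log 2)
        ⟨by linarith [hs.1], by linarith [hs.2]⟩
      exact ⟨t, fun _ => ⟨ht, by linarith⟩⟩
    -- Off the interval the value of `τ` is arbitrary.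
    · exact ⟨0, fun h => absurd h hs⟩
  choose τ hτ using hex
  refine ⟨fun s hs => ?_, τ, fun s hs s' hs' hlt => ?_, fun s hs => ⟨fun t ht => ?_, ?_, ?_, ?_⟩⟩
  · have : {ε : ℝ | QLDP.IsECLMPrivate QLDP.asymmetricMechanism s ε} = ∅ :=
      Set.eq_empty_of_forall_notMem fun ε => QLDP.not_isECLMPrivate_of_le_log_two hs ε
    rw [QLDP.optimalLeakage, this, Set.image_empty, sInf_empty]
  · obtain ⟨h1, h2⟩ := hτ s hs
    obtain ⟨h1', h2'⟩ := hτ s' hs'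
    refine (Real.binEntropy_strictAntiOn.lt_iff_gt ⟨h1.1, h1.2.le⟩ ⟨h1'.1, h1'.2.le⟩).1 ?_
    linarith
  · obtain ⟨h1, h2⟩ := hτ s hs
    rw [← QLDP.log_two_add_binEntropy]
    refine ⟨fun h => ?_, fun h => h ▸ h2.symm⟩
    exact Real.binEntropy_strictAntiOn.injOn (by rwa [one_div] at ht) ⟨h1.1, h1.2.le⟩
      (by linarith)
  · simpa using (hτ s hs).1.1
  · exact (hτ s hs).1.2
  · obtain ⟨h1, h2⟩ := hτ s hs
    have := QLDP.isECLMPrivate_asymmetricMechanism h1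
    rw [h2] at this
    exact sInf_le ⟨_, this, rfl⟩
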